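/- Let $\alpha,\beta\in\mathbb{R}$ and let $\Phi_{\alpha,\beta}(\rho)=K_1\rho K_1^*+K_2\rho K_2^*$ be the map on $2\times 2$ complex matrices with Kraus operators $$K_1=\begin{pmatrix}\cos\alpha&0\\0&\cos\beta\end{pmatrix},\qquad K_2=\begin{pmatrix}0&\sin\beta\\\sin\alpha&0\end{pmatrix}.$$ Then $\Phi_{\alpha,\beta}$ is a quantum channel (a completely positive trace-preserving linear map), and the condition $|\sin(\alpha+\beta)|=|\cos(\beta-\alpha)|$ is equivalent to $\cos(2\alpha)\cos(2\beta)=0$. If this condition holds, then $\Phi_{\alpha,\beta}$ is both degradable and antidegradable. Here, for an isometry $V:\mathbb{C}^2\to\mathbb{C}^2\otimes\mathbb{C}^d$ with $\Phi(\rho)=\operatorname{tr}_{\mathbb{C}^d}(V\rho V^*)$ for all $\rho$, the map $\widetilde\Phi(\rho)=\operatorname{tr}_{\mathbb{C}^2}(V\rho V^*)$ is called a complementary channel of $\Phi$. A channel $\Phi$ is degradable if $\widetilde\Phi=\Gamma\circ\Phi$ for some complementary channel $\widetilde\Phi$ of $\Phi$ and some quantum channel $\Gamma$, and antidegradable if $\Phi=\Xi\circ\widetilde\Phi$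 for some complementary channel $\widetilde\Phi$ of $\Phi$ and some quantum channel $\Xi$. -/

import Mathlib

open scoped Matrix CStarAlgebra ComplexOrder

namespace QubitChannel

/-- A quantum channel `L(ℂⁿ) → L(ℂᵐ)`: a linear map that is completely positive (as a map between
the C⋆-algebras of complex matrices) and trace preserving. -/
def IsChannel {n m : Type} [Fintype n] [Fintype m]
    (Φ : Matrix n n ℂ →ₗ[ℂ] Matrix m m ℂ) : Prop :=
  (∃ F : CStarMatrix n n ℂ →CP CStarMatrix m m ℂ,
      ∀ X : Matrix n n ℂ, F (CStarMatrix.ofMatrix X) = CStarMatrix.ofMatrix (Φ X)) ∧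
    ∀ X : Matrix n n ℂ, (Φ X).trace = X.trace

/-- Partial trace over the second tensor factor. -/
def traceSnd {m d : Type} [Fintype d] (M : Matrix (m × d) (m × d) ℂ) : Matrix m m ℂ :=
  Matrix.of fun i j => ∑ k, M (i, k) (j, k)

/-- Partial trace over the first tensor factor. -/
def traceFst {m d : Type} [Fintype m] (M : Matrix (m × d) (m × d) ℂ) : Matrix d d ℂ :=
  Matrix.of fun k l => ∑ i, M (i, k) (i, l)

/-- `Ψ` is a complementary channel of `Φ`: for some isometry `V : ℂⁿ → ℂᵐ ⊗ ℂᵈ`, the map `Φ` is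
`ρ ↦ tr_{ℂᵈ}(V ρ V*)` and `Ψ` is `ρ ↦ tr_{ℂᵐ}(V ρ V*)`. -/
def IsComplementary {n m d : Type} [Fintype n] [DecidableEq n] [Fintype m] [Fintype d]
    (Φ : Matrix n n ℂ →ₗ[ℂ] Matrix m m ℂ) (Ψ : Matrix n n ℂ →ₗ[ℂ] Matrix d d ℂ) : Prop :=
  ∃ V : Matrix (m × d) n ℂ, Vᴴ * V = 1 ∧
    (∀ ρ, Φ ρ = traceSnd (V * ρ * Vᴴ)) ∧ ∀ ρ, Ψ ρ = traceFst (V * ρ * Vᴴ)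

/-- `Φ` is degradable: its complementary channel is `Γ ∘ Φ` for some channel `Γ`. The complementary
channel is unique up to an isometric change of environment, so the condition does not depend on
which one is taken. -/
def IsDegradable {n m : Type} [Fintype n] [DecidableEq n] [Fintype m]
    (Φ : Matrix n n ℂ →ₗ[ℂ] Matrix m m ℂ) : Prop :=
  ∃ (d : ℕ) (Ψ : Matrix n n ℂ →ₗ[ℂ] Matrix (Fin d) (Fin d) ℂ), IsComplementary Φ Ψ ∧
    ∃ Γ : Matrix m m ℂ →ₗ[ℂ] Matrix (Fin d) (Fin d) ℂ, IsChannel Γ ∧ Ψ = Γ ∘ₗ Φ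

/-- `Φ` is antidegradable: it is `Ξ ∘ Ψ` with `Ψ` its complementary channel and `Ξ` some
channel. -/
def IsAntidegradable {n m : Type} [Fintype n] [DecidableEq n] [Fintype m]
    (Φ : Matrix n n ℂ →ₗ[ℂ] Matrix m m ℂ) : Prop :=
  ∃ (d : ℕ) (Ψ : Matrix n n ℂ →ₗ[ℂ] Matrix (Fin d) (Fin d) ℂ), IsComplementary Φ Ψ ∧
    ∃ Ξ : Matrix (Fin d) (Fin d) ℂ →ₗ[ℂ] Matrix m m ℂ, IsChannel Ξ ∧ Φ = Ξ ∘ₗ Ψ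

/-- The first Kraus operator. -/
noncomputable def K₁ (α β : ℝ) : Matrix (Fin 2) (Fin 2) ℂ :=
  !![(Real.cos α : ℂ), 0; 0, (Real.cos β : ℂ)]

/-- The second Kraus operator. -/
noncomputable def K₂ (α β : ℝ) : Matrix (Fin 2) (Fin 2) ℂ :=
  !![0, (Real.sin β : ℂ); (Real.sin α : ℂ), 0]

/-- The qubit map with Kraus operators `K₁, K₂`: `ρ ↦ K₁ ρ K₁* + K₂ ρ K₂*`. -/
noncomputable def qubitChannel (α β : ℝ) :
    Matrix (Fin 2) (Fin 2) ℂ →ₗ[ℂ] Matrix (Fin 2) (Fin 2) ℂ where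
  toFun ρ := K₁ α β * ρ * (K₁ α β)ᴴ + K₂ α β * ρ * (K₂ α β)ᴴ
  map_add' ρ σ := by
    simp only [Matrix.mul_add, Matrix.add_mul]
    abel
  map_smul' c ρ := by
    simp only [Matrix.mul_smul, Matrix.smul_mul, smul_add, RingHom.id_apply]

end QubitChannel

/-!
Let `V` be the Stinespring isometry stacking the Kraus operators `K i`. Tracing out the system
instead of the environment exchanges the operator index with the row index, so the complementary
channel is again given by Kraus operators; for the qubit family this exchange is `β ↦ π / 2 - β`.

Since `cos (2 * α) * cos (2 * β) = cos (β - α) ^ 2 - sin (α + β) ^ 2`, the condition says that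
`sin x = ε * cos x` with `ε ^ 2 = 1` for `x = α` or `x = β`. In either case `β ↦ π / 2 - β` alters
the Kraus operators only by a left unitary factor, signs and a permutation, so it conjugates the
channel by a unitary. Unitary conjugation is a channel, and so is its inverse.
-/

namespace QubitChannel

theorem cstarMatrix_map_nonneg_of_map_star_mul {A B τ k : Type*} [NonUnitalCStarAlgebra A]
    [NonUnitalCStarAlgebra B] [PartialOrder A] [PartialOrder B] [StarOrderedRing A]
    [StarOrderedRing B] [Fintype τ] [Fintype k] {φ : A →ₗ[ℂ] B} {ψ : τ → A → B}
    (hφ : ∀ x y, φ (star x * y) = ∑ t, star (ψ t x) * ψ t y)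
    {M : CStarMatrix k k A} (hM : 0 ≤ M) : 0 ≤ M.map φ := by
  have map_star_mul_self (N : CStarMatrix k k A) :
      (star N * N).map φ = ∑ t, star (N.map (ψ t)) * N.map (ψ t) := by
    ext p q
    calc φ ((star N * N) p q) = ∑ r, ∑ t, star (ψ t (N r p)) * ψ t (N r q) := by
          simp only [CStarMatrix.mul_apply, CStarMatrix.star_apply, map_sum, hφ]
      _ = ∑ t, (star (N.map (ψ t)) * N.map (ψ t)) p q := by
          rw [Finset.sum_comm]
          simp only [CStarMatrix.mul_apply, CStarMatrix.star_apply, CStarMatrix.map_apply]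
      _ = (∑ t, star (N.map (ψ t)) * N.map (ψ t)) p q := (Matrix.sum_apply p q _ _).symm
  rw [StarOrderedRing.nonneg_iff] at hM
  induction hM using AddSubmonoid.closure_induction with
  | mem _ hx =>
    obtain ⟨N, rfl⟩ := hx
    exact map_star_mul_self N ▸ Finset.sum_nonneg fun t _ => star_mul_self_nonneg _
  | zero => exact ((CStarMatrix.mapₗ (m := k) (n := k) φ).map_zero).ge
  | add x y _ _ hx hy =>
    exact (add_nonneg hx hy).trans_eq ((CStarMatrix.mapₗ φ).map_add x y).symm

section Kraus

variable {n m ι κ : Type} [Fintype n] [Fintype ι] [Fintype κ]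

/-- The linear map `ρ ↦ ∑ i, K i * ρ * (K i)ᴴ` with Kraus operators `K i`. -/
def krausMap (K : ι → Matrix m n ℂ) : Matrix n n ℂ →ₗ[ℂ] Matrix m m ℂ where
  toFun ρ := ∑ i, K i * ρ * (K i)ᴴ
  map_add' ρ σ := by simp only [Matrix.mul_add, Matrix.add_mul, Finset.sum_add_distrib]
  map_smul' c ρ := by
    simp only [Matrix.mul_smul, Matrix.smul_mul, Finset.smul_sum, RingHom.id_apply]

theorem krausMap_apply (K : ι → Matrix m n ℂ) (ρ : Matrix n n ℂ) :
    krausMap K ρ = ∑ i, K i * ρ * (K i)ᴴ := rfl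

/-- The Kraus operators of the complementary channel: the operator index and the row index of `K`
are exchanged. -/
def complementaryKraus (K : ι → Matrix m n ℂ) (a : m) : Matrix ι n ℂ :=
  Matrix.of fun i j => K i a j

variable [Fintype m]

theorem trace_krausMap (K : ι → Matrix m n ℂ) (ρ : Matrix n n ℂ) :
    (krausMap K ρ).trace = ((∑ i, (K i)ᴴ * K i) * ρ).trace := by
  simp only [krausMap_apply, Matrix.trace_sum, Finset.sum_mul]
  exact Finset.sum_congr rfl fun i _ => by rw [Matrix.trace_mul_comm, Matrix.mul_assoc]

theorem exists_krausMap_conjTranspose_mul_eq (K : ι → Matrix m n ℂ) :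
    ∃ ψ : ι × n → Matrix n n ℂ → Matrix m m ℂ,
      ∀ X Y, krausMap K (Xᴴ * Y) = ∑ t, (ψ t X)ᴴ * ψ t Y := by
  classical
  cases isEmpty_or_nonempty m with
  | inl _ => exact ⟨0, fun _ _ => Subsingleton.elim _ _⟩
  | inr h_nonempty =>
    obtain ⟨a⟩ := h_nonempty
    -- The matrix units `E s` turn the rectangular `X * (K i)ᴴ` into elements of `Matrix m m ℂ`.
    let E (s : n) : Matrix m n ℂ := Matrix.single a s 1
    have sum_units : ∑ s, (E s)ᴴ * E s = 1 := by simp [E, Matrix.sum_single_one]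
    refine ⟨fun t X => E t.2 * X * (K t.1)ᴴ, fun X Y => ?_⟩
    rw [krausMap_apply, Fintype.sum_prod_type]
    refine Finset.sum_congr rfl fun i _ => ?_
    calc K i * (Xᴴ * Y) * (K i)ᴴ
        = K i * Xᴴ * (∑ s, (E s)ᴴ * E s) * Y * (K i)ᴴ := by
          simp only [sum_units, Matrix.mul_one, Matrix.mul_assoc]
      _ = ∑ s, (E s * X * (K i)ᴴ)ᴴ * (E s * Y * (K i)ᴴ) := by
          simp only [Matrix.mul_sum, Matrix.sum_mul, Matrix.conjTranspose_mul,
            Matrix.conjTranspose_conjTranspose, Matrix.mul_assoc]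

theorem isChannel_krausMap [DecidableEq n] {K : ι → Matrix m n ℂ}
    (hK : ∑ i, (K i)ᴴ * K i = 1) : IsChannel (krausMap K) := by
  obtain ⟨ψ, hψ⟩ := exists_krausMap_conjTranspose_mul_eq K
  let φ : CStarMatrix n n ℂ →ₗ[ℂ] CStarMatrix m m ℂ :=
    (CStarMatrix.ofMatrixₗ (R := ℂ)).toLinearMap ∘ₗ krausMap K ∘ₗ
      (CStarMatrix.ofMatrixₗ (R := ℂ)).symm.toLinearMap
  have hφ : ∀ X Y, φ (star X * Y) = ∑ t, star (CStarMatrix.ofMatrix (ψ t X)) *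
    CStarMatrix.ofMatrix (ψ t Y) := hψ
  refine ⟨⟨⟨φ, fun _ _ hM => cstarMatrix_map_nonneg_of_map_star_mul hφ hM⟩, fun _ => rfl⟩,
    fun ρ => ?_⟩
  rw [trace_krausMap, hK, one_mul]

theorem isComplementary_krausMap [DecidableEq n] {K : ι → Matrix m n ℂ}
    (hK : ∑ i, (K i)ᴴ * K i = 1) :
    IsComplementary (krausMap K) (krausMap (complementaryKraus K)) := by
  let V : Matrix (m × ι) n ℂ := Matrix.of fun p j => K p.2 p.1 j
  refine ⟨V, ?_, fun ρ => ?_, fun ρ => ?_⟩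
  · rw [← hK]
    ext i j
    simp only [V, Matrix.mul_apply, Matrix.sum_apply, Matrix.conjTranspose_apply, Matrix.of_apply,
      Fintype.sum_prod_type_right]
  · ext a b
    simp only [V, krausMap_apply, traceSnd, Matrix.mul_apply, Matrix.sum_apply,
      Matrix.conjTranspose_apply, Matrix.of_apply]
  · ext i j
    simp only [V, krausMap_apply, complementaryKraus, traceFst, Matrix.mul_apply, Matrix.sum_apply,
      Matrix.conjTranspose_apply, Matrix.of_apply]

/-- Conjugation `ρ ↦ U * ρ * Uᴴ` by a unitary matrix, as a linear automorphism. -/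
def unitaryConj [DecidableEq m] (U : Matrix.unitaryGroup m ℂ) :
    Matrix m m ℂ ≃ₗ[ℂ] Matrix m m ℂ :=
  (Unitary.conjStarAlgAut ℂ (Matrix m m ℂ) U).toAlgEquiv.toLinearEquiv

theorem unitaryConj_apply [DecidableEq m] (U : Matrix.unitaryGroup m ℂ) (ρ : Matrix m m ℂ) :
    unitaryConj U ρ = (U : Matrix m m ℂ) * ρ * (U : Matrix m m ℂ)ᴴ := rfl

theorem unitaryConj_symm [DecidableEq m] (U : Matrix.unitaryGroup m ℂ) :
    (unitaryConj U).symm = unitaryConj (star U) := by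
  ext1 ρ
  simp only [unitaryConj, ← Unitary.conjStarAlgAut_symm]
  rfl

theorem isChannel_unitaryConj [DecidableEq m] (U : Matrix.unitaryGroup m ℂ) :
    IsChannel (unitaryConj U : Matrix m m ℂ →ₗ[ℂ] Matrix m m ℂ) := by
  have h_kraus : krausMap (fun _ : Unit => (U : Matrix m m ℂ)) = unitaryConj U := by
    ext1 ρ
    simp [krausMap_apply, unitaryConj_apply]
  rw [← h_kraus]
  exact isChannel_krausMap (by
    rw [Fintype.sum_unique]
    exact Matrix.UnitaryGroup.star_mul_self U)

theorem krausMap_eq_unitaryConj_comp [DecidableEq m] {K : ι → Matrix m n ℂ}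
    {L : κ → Matrix m n ℂ} (U : Matrix.unitaryGroup m ℂ) (e : κ ≃ ι) {c : κ → ℂ}
    (hc : ∀ i, c i ∈ unitary ℂ) (hL : ∀ i, L i = c i • ((U : Matrix m m ℂ) * K (e i))) :
    krausMap L = unitaryConj U ∘ₗ krausMap K := by
  ext1 ρ
  calc krausMap L ρ
      = ∑ i, (U : Matrix m m ℂ) * (K (e i) * ρ * (K (e i))ᴴ) * (U : Matrix m m ℂ)ᴴ := by
        refine Finset.sum_congr rfl fun i _ => ?_
        simp only [hL, Matrix.conjTranspose_smul, Matrix.conjTranspose_mul, Matrix.smul_mul,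
          Matrix.mul_smul, smul_smul, Unitary.star_mul_self_of_mem (hc i), one_smul,
          Matrix.mul_assoc]
    _ = unitaryConj U (krausMap K ρ) := by
        rw [unitaryConj_apply, krausMap_apply, Matrix.mul_sum, Matrix.sum_mul]
        exact e.sum_comp fun i => (U : Matrix m m ℂ) * (K i * ρ * (K i)ᴴ) * (U : Matrix m m ℂ)ᴴ

end Kraus

theorem IsComplementary.isDegradable_and_isAntidegradable {n m : Type} [Fintype n] [DecidableEq n]
    [Fintype m] {d : ℕ} {Φ : Matrix n n ℂ →ₗ[ℂ] Matrix m m ℂ}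
    {Ψ : Matrix n n ℂ →ₗ[ℂ] Matrix (Fin d) (Fin d) ℂ} (h : IsComplementary Φ Ψ)
    {Γ : Matrix m m ℂ ≃ₗ[ℂ] Matrix (Fin d) (Fin d) ℂ} (hΓ : IsChannel Γ.toLinearMap)
    (hΓ_symm : IsChannel Γ.symm.toLinearMap) (hΨ : Ψ = Γ ∘ₗ Φ) :
    IsDegradable Φ ∧ IsAntidegradable Φ :=
  ⟨⟨d, Ψ, h, Γ, hΓ, hΨ⟩, ⟨d, Ψ, h, Γ.symm, hΓ_symm,
    (LinearEquiv.eq_toLinearMap_symm_comp _ _).mpr hΨ.symm⟩⟩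

/-- The Kraus operators of `qubitChannel α β` as a family, so that the index set is the
environment. -/
noncomputable def qubitKraus (α β : ℝ) : Fin 2 → Matrix (Fin 2) (Fin 2) ℂ :=
  ![K₁ α β, K₂ α β]

theorem qubitChannel_eq_krausMap (α β : ℝ) : qubitChannel α β = krausMap (qubitKraus α β) := by
  ext1 ρ
  simp [qubitChannel, krausMap_apply, qubitKraus]

theorem sum_qubitKraus_conjTranspose_mul_self (α β : ℝ) :
    ∑ i, (qubitKraus α β i)ᴴ * qubitKraus α β i = 1 := by
  have cos_sq_add_sin_sq (x : ℝ) :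
      (Real.cos x : ℂ) * Real.cos x + Real.sin x * Real.sin x = 1 := by
    exact_mod_cast (by simpa only [sq] using Real.cos_sq_add_sin_sq x)
  ext i j
  fin_cases i <;> fin_cases j <;>
    simp [qubitKraus, K₁, K₂, -Complex.ofReal_cos, -Complex.ofReal_sin, Matrix.mul_apply,
      cos_sq_add_sin_sq]

theorem isChannel_qubitChannel (α β : ℝ) : IsChannel (qubitChannel α β) :=
  qubitChannel_eq_krausMap α β ▸
    isChannel_krausMap (sum_qubitKraus_conjTranspose_mul_self α β)

theorem K₁_pi_div_two_sub (α β : ℝ) :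
    K₁ α (Real.pi / 2 - β) = !![(Real.cos α : ℂ), 0; 0, (Real.sin β : ℂ)] := by
  rw [K₁, Real.cos_pi_div_two_sub]

theorem K₂_pi_div_two_sub (α β : ℝ) :
    K₂ α (Real.pi / 2 - β) = !![0, (Real.cos β : ℂ); (Real.sin α : ℂ), 0] := by
  rw [K₂, Real.sin_pi_div_two_sub]

theorem complementaryKraus_qubitKraus (α β : ℝ) :
    complementaryKraus (qubitKraus α β) = qubitKraus α (Real.pi / 2 - β) := by
  rw [qubitKraus, qubitKraus, K₁_pi_div_two_sub, K₂_pi_div_two_sub]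
  ext a i j
  fin_cases a <;> fin_cases i <;> fin_cases j <;> simp [complementaryKraus, K₁, K₂]

theorem isComplementary_qubitChannel (α β : ℝ) :
    IsComplementary (qubitChannel α β) (qubitChannel α (Real.pi / 2 - β)) := by
  simpa only [qubitChannel_eq_krausMap, complementaryKraus_qubitKraus] using
    isComplementary_krausMap (sum_qubitKraus_conjTranspose_mul_self α β)

theorem abs_sin_add_eq_abs_cos_sub_iff (α β : ℝ) :
    |Real.sin (α + β)| = |Real.cos (β - α)| ↔ Real.cos (2 * α) * Real.cos (2 * β) = 0 := by
  have cos_mul_cos : Real.cos (2 * α) * Real.cos (2 * β) =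
      Real.cos (β - α) ^ 2 - Real.sin (α + β) ^ 2 := by
    rw [Real.cos_two_mul', Real.cos_two_mul', Real.cos_sub, Real.sin_add]
    ring
  rw [← sq_eq_sq_iff_abs_eq_abs, cos_mul_cos, sub_eq_zero, eq_comm]

theorem exists_sin_eq_mul_cos_of_cos_two_mul_eq_zero {x : ℝ} (h : Real.cos (2 * x) = 0) :
    ∃ ε : ℝ, ε * ε = 1 ∧ Real.sin x = ε * Real.cos x := by
  rw [Real.cos_two_mul', sub_eq_zero] at h
  rcases sq_eq_sq_iff_eq_or_eq_neg.mp h with h | h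
  · exact ⟨1, by norm_num, by rw [h, one_mul]⟩
  · exact ⟨-1, by norm_num, by rw [h]; ring⟩

theorem ofReal_mem_unitary_of_mul_self_eq_one {x : ℝ} (h : x * x = 1) : (x : ℂ) ∈ unitary ℂ := by
  rw [Unitary.mem_iff]
  simpa using (mod_cast h : (x : ℂ) * x = 1)

theorem diagonal_fin_two_mem_unitaryGroup {R : Type*} [CommRing R] [StarRing R] {a b : R}
    (ha : a ∈ unitary R) (hb : b ∈ unitary R) :
    !![a, 0; 0, b] ∈ Matrix.unitaryGroup (Fin 2) R := by
  rw [Matrix.mem_unitaryGroup_iff, Matrix.eta_fin_two (star _)]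
  simpa [Matrix.one_fin_two] using
    ⟨Unitary.mul_star_self_of_mem ha, Unitary.mul_star_self_of_mem hb⟩

theorem antidiagonal_fin_two_mem_unitaryGroup {R : Type*} [CommRing R] [StarRing R] {a b : R}
    (ha : a ∈ unitary R) (hb : b ∈ unitary R) :
    !![0, a; b, 0] ∈ Matrix.unitaryGroup (Fin 2) R := by
  rw [Matrix.mem_unitaryGroup_iff, Matrix.eta_fin_two (star _)]
  simpa [Matrix.one_fin_two] using
    ⟨Unitary.mul_star_self_of_mem ha, Unitary.mul_star_self_of_mem hb⟩

theorem exists_unitaryConj_of_cos_two_mul_left_eq_zero {α : ℝ} (β : ℝ)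
    (hα : Real.cos (2 * α) = 0) :
    ∃ U : Matrix.unitaryGroup (Fin 2) ℂ,
      qubitChannel α (Real.pi / 2 - β) = unitaryConj U ∘ₗ qubitChannel α β := by
  obtain ⟨ε, hε, h_sin⟩ := exists_sin_eq_mul_cos_of_cos_two_mul_eq_zero hα
  have hε_unitary : (ε : ℂ) ∈ unitary ℂ := ofReal_mem_unitary_of_mul_self_eq_one hε
  have hεε : (ε : ℂ) * ε = 1 := mod_cast hε
  let U : Matrix.unitaryGroup (Fin 2) ℂ :=
    ⟨!![0, 1; (ε : ℂ), 0], antidiagonal_fin_two_mem_unitaryGroup (one_mem _) hε_unitary⟩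
  have hK₁ : K₁ α (Real.pi / 2 - β) = (ε : ℂ) • ((U : Matrix (Fin 2) (Fin 2) ℂ) * K₂ α β) := by
    rw [K₁_pi_div_two_sub]
    simp [K₂, U, h_sin, hεε, ← mul_assoc, -Complex.ofReal_cos, -Complex.ofReal_sin]
  have hK₂ : K₂ α (Real.pi / 2 - β) = (1 : ℂ) • ((U : Matrix (Fin 2) (Fin 2) ℂ) * K₁ α β) := by
    rw [K₂_pi_div_two_sub]
    simp [K₁, U, h_sin, -Complex.ofReal_cos, -Complex.ofReal_sin]
  refine ⟨U, ?_⟩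
  rw [qubitChannel_eq_krausMap, qubitChannel_eq_krausMap]
  exact krausMap_eq_unitaryConj_comp U (Equiv.swap 0 1) (c := ![(ε : ℂ), 1])
    (Fin.forall_fin_two.mpr ⟨hε_unitary, one_mem _⟩) (Fin.forall_fin_two.mpr ⟨hK₁, hK₂⟩)

theorem exists_unitaryConj_of_cos_two_mul_right_eq_zero (α : ℝ) {β : ℝ}
    (hβ : Real.cos (2 * β) = 0) :
    ∃ U : Matrix.unitaryGroup (Fin 2) ℂ,
      qubitChannel α (Real.pi / 2 - β) = unitaryConj U ∘ₗ qubitChannel α β := by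
  obtain ⟨ε, hε, h_sin⟩ := exists_sin_eq_mul_cos_of_cos_two_mul_eq_zero hβ
  have hε_unitary : (ε : ℂ) ∈ unitary ℂ := ofReal_mem_unitary_of_mul_self_eq_one hε
  have hεε : (ε : ℂ) * ε = 1 := mod_cast hε
  let U : Matrix.unitaryGroup (Fin 2) ℂ :=
    ⟨!![1, 0; 0, (ε : ℂ)], diagonal_fin_two_mem_unitaryGroup (one_mem _) hε_unitary⟩
  have hK₁ : K₁ α (Real.pi / 2 - β) = (1 : ℂ) • ((U : Matrix (Fin 2) (Fin 2) ℂ) * K₁ α β) := by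
    rw [K₁_pi_div_two_sub]
    simp [K₁, U, h_sin, -Complex.ofReal_cos, -Complex.ofReal_sin]
  have hK₂ : K₂ α (Real.pi / 2 - β) = (ε : ℂ) • ((U : Matrix (Fin 2) (Fin 2) ℂ) * K₂ α β) := by
    rw [K₂_pi_div_two_sub]
    simp [K₂, U, h_sin, hεε, ← mul_assoc, -Complex.ofReal_cos, -Complex.ofReal_sin]
  refine ⟨U, ?_⟩
  rw [qubitChannel_eq_krausMap, qubitChannel_eq_krausMap]
  exact krausMap_eq_unitaryConj_comp U (Equiv.refl _) (c := ![1, (ε : ℂ)])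
    (Fin.forall_fin_two.mpr ⟨one_mem _, hε_unitary⟩) (Fin.forall_fin_two.mpr ⟨hK₁, hK₂⟩)

theorem isDegradable_and_isAntidegradable_qubitChannel {α β : ℝ}
    (h : Real.cos (2 * α) * Real.cos (2 * β) = 0) :
    IsDegradable (qubitChannel α β) ∧ IsAntidegradable (qubitChannel α β) := by
  obtain ⟨U, hU⟩ := (mul_eq_zero.mp h).elim (exists_unitaryConj_of_cos_two_mul_left_eq_zero β)
    (exists_unitaryConj_of_cos_two_mul_right_eq_zero α)
  exact (isComplementary_qubitChannel α β).isDegradable_and_isAntidegradable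
    (isChannel_unitaryConj U) (unitaryConj_symm U ▸ isChannel_unitaryConj (star U)) hU

end QubitChannel

theorem mainTheorem10 (α β : ℝ) :
    QubitChannel.IsChannel (QubitChannel.qubitChannel α β) ∧
    (|Real.sin (α + β)| = |Real.cos (β - α)| ↔ Real.cos (2 * α) * Real.cos (2 * β) = 0) ∧
    (|Real.sin (α + β)| = |Real.cos (β - α)| →
      QubitChannel.IsDegradable (QubitChannel.qubitChannel α β) ∧
      QubitChannel.IsAntidegradable (QubitChannel.qubitChannel α β)) := by
  exact ⟨QubitChannel.isChannel_qubitChannel α β, QubitChannel.abs_sin_add_eq_abs_cos_sub_iff α β,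
    fun h => QubitChannel.isDegradable_and_isAntidegradable_qubitChannel
      ((QubitChannel.abs_sin_add_eq_abs_cos_sub_iff α β).mp h)⟩
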